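/- An \emph{$L$-algebra} is a set $X$ with a binary operation $(x,y)\mapsto x\cdot y$ and an element $1\in X$ such that, for all $x,y,z\in X$, $x\cdot x=x\cdot 1=1$, $1\cdot x=x$, $(x\cdot y)\cdot(x\cdot z)=(y\cdot x)\cdot(y\cdot z)$, and $x\cdot y=y\cdot x=1$ implies $x=y$. An \emph{ideal} of $X$ is a subset $I$ with $1\in I$ such that, for all $x,y\in X$: $x\in I$ and $x\cdot y\in I$ imply $y\in I$; and $x\in I$ implies $(x\cdot y)\cdot y\in I$, $y\cdot x\in I$ and $y\cdot(x\cdot y)\in I$. Write $\langle S\rangle$ for the smallest ideal containing $S\subseteq X$; an ideal is \emph{finitely generated} if it equals $\langle S\rangle$ for some finite $S$. For ideals $I,J$ put $I\cdot J=\{x\in X : \langle \{x\}\rangle\cap I\subseteq J\}$. An ideal $P\neq X$ is \emph{prime} if for every ideal $I$ either $I\subseteq P$ or $I\cdot P\subseteq P$. Let $\operatorname{Spec}X$ be the set of prime ideals of $X$, with the topology whose open sets are precisely the sets $U_I=\{P\in\operatorname{Spec}X : I\not\subseteq P\}$, where $I$ runs over the ideals of $X$. Let $X$ be an $L$-algebra.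 Then: 1. $\operatorname{Spec}X$ is a $T_0$-space, and it is sober: every non-empty closed irreducible subset $A$ is the closure of $\{P\}$ for a unique point $P\in\operatorname{Spec}X$. 2. The quasi-compact open sets form a basis of the topology of $\operatorname{Spec}X$. 3. For every ideal $I$ of $X$, the open set $U_I$ is quasi-compact if and only if $I$ is finitely generated, and $I\mapsto U_I$ is a bijection from the set of finitely generated ideals of $X$ onto the set of quasi-compact open subsets of $\operatorname{Spec}X$. -/

import Mathlib

/-- An `L`-algebra: a set with a binary operation `x ⇝ y` and a logical unit `1`. -/
class LAlgebra (X : Type*) extends One X where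
  /-- The operation, written `x · y` on paper and `x ⇝ y` here. -/
  op : X → X → X
  op_self : ∀ x : X, op x x = 1
  op_one : ∀ x : X, op x 1 = 1
  one_op : ∀ x : X, op 1 x = x
  op_op_op : ∀ x y z : X, op (op x y) (op x z) = op (op y x) (op y z)
  eq_of_op_eq_one : ∀ x y : X, op x y = 1 → op y x = 1 → x = y

namespace LAlgebra

infix:70 " ⇝ " => LAlgebra.op

/-- Ideals of an `L`-algebra. -/
structure LIdeal (X : Type*) [LAlgebra X] where
  carrier : Set X
  one_mem' : 1 ∈ carrier
  mem_of_op_mem' : ∀ x y : X, x ∈ carrier → x ⇝ y ∈ carrier → y ∈ carrier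
  op_op_mem' : ∀ x y : X, x ∈ carrier → (x ⇝ y) ⇝ y ∈ carrier
  op_mem' : ∀ x y : X, x ∈ carrier → y ⇝ x ∈ carrier
  op_op_mem_right' : ∀ x y : X, x ∈ carrier → y ⇝ (x ⇝ y) ∈ carrier

namespace LIdeal

variable {X : Type*} [LAlgebra X]

instance : SetLike (LIdeal X) X where
  coe := LIdeal.carrier
  coe_injective I J h := by
    cases I; cases J; congr

/-- Ideals are ordered by inclusion. -/
instance : PartialOrder (LIdeal X) := .ofSetLike (LIdeal X) X

/-- The intersection of two ideals. -/
def inter (I J : LIdeal X) : LIdeal X where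
  carrier := (I : Set X) ∩ (J : Set X)
  one_mem' := ⟨I.one_mem', J.one_mem'⟩
  mem_of_op_mem' := fun x y hx hxy =>
    ⟨I.mem_of_op_mem' x y hx.1 hxy.1, J.mem_of_op_mem' x y hx.2 hxy.2⟩
  op_op_mem' := fun x y hx => ⟨I.op_op_mem' x y hx.1, J.op_op_mem' x y hx.2⟩
  op_mem' := fun x y hx => ⟨I.op_mem' x y hx.1, J.op_mem' x y hx.2⟩
  op_op_mem_right' := fun x y hx =>
    ⟨I.op_op_mem_right' x y hx.1, J.op_op_mem_right' x y hx.2⟩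

/-- The ideal of all elements. -/
def univ (X : Type*) [LAlgebra X] : LIdeal X where
  carrier := Set.univ
  one_mem' := trivial
  mem_of_op_mem' := fun _ _ _ _ => trivial
  op_op_mem' := fun _ _ _ => trivial
  op_mem' := fun _ _ _ => trivial
  op_op_mem_right' := fun _ _ _ => trivial

/-- The ideal generated by a subset: the intersection of all ideals that contain it. -/
def span (s : Set X) : LIdeal X where
  carrier := {x | ∀ I : LIdeal X, s ⊆ (I : Set X) → x ∈ I}
  one_mem' := fun I _ => I.one_mem'
  mem_of_op_mem' := fun x y hx hxy I hI => I.mem_of_op_mem' x y (hx I hI) (hxy I hI)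
  op_op_mem' := fun x y hx I hI => I.op_op_mem' x y (hx I hI)
  op_mem' := fun x y hx I hI => I.op_mem' x y (hx I hI)
  op_op_mem_right' := fun x y hx I hI => I.op_op_mem_right' x y (hx I hI)

theorem subset_span (s : Set X) : s ⊆ (span s : Set X) := fun _ hx _ hI => hI hx

theorem span_le {s : Set X} {I : LIdeal X} : span s ≤ I ↔ s ⊆ (I : Set X) :=
  ⟨fun h _ hx => h (subset_span s hx), fun h _ hx => hx I h⟩

/-- An ideal is finitely generated if it is generated by a finite subset. -/
def FG (I : LIdeal X) : Prop := ∃ s : Set X, s.Finite ∧ I = span s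

/-- The operation `I · J = {x | ⟨x⟩ ∩ I ⊆ J}` on ideals. -/
def residual (I J : LIdeal X) : Set X :=
  {x | (span {x} : Set X) ∩ (I : Set X) ⊆ (J : Set X)}

/-- An ideal `P` is prime if it is proper and, for every ideal `I`, either `I ⊆ P` or
`I · P ⊆ P`. -/
def IsPrime (P : LIdeal X) : Prop :=
  (P : Set X) ≠ Set.univ ∧ ∀ I : LIdeal X, I ≤ P ∨ residual I P ⊆ (P : Set X)

theorem IsPrime.le_or_le {P : LIdeal X} (hP : P.IsPrime) {I J : LIdeal X}
    (h : inter I J ≤ P) : I ≤ P ∨ J ≤ P := by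
  rcases hP.2 I with hI | hI
  · exact Or.inl hI
  · refine Or.inr fun x hx => hI ?_
    rintro y ⟨hy, hyI⟩
    exact h (show y ∈ inter I J from
      ⟨hyI, (span_le.2 (Set.singleton_subset_iff.2 hx) : span {x} ≤ J) hy⟩)

end LIdeal

/-- The spectrum of an `L`-algebra: the set of its prime ideals. -/
def Spectrum (X : Type*) [LAlgebra X] : Type _ := {P : LIdeal X // P.IsPrime}

namespace Spectrum

variable {X : Type*} [LAlgebra X]

/-- The set `U_I` of all prime ideals that do not contain the ideal `I`. -/
def U (I : LIdeal X) : Set (Spectrum X) := {P | ¬ I ≤ P.1}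

/-- The topology on the spectrum: the open sets are precisely the sets `U_I`. -/
instance : TopologicalSpace (Spectrum X) where
  IsOpen V := ∃ I : LIdeal X, V = U I
  isOpen_univ := ⟨LIdeal.univ X, by
    refine (Set.eq_univ_of_forall fun P h => P.2.1 ?_).symm
    exact Set.eq_univ_of_forall fun x => h (Set.mem_univ x)⟩
  isOpen_inter := by
    rintro _ _ ⟨I, rfl⟩ ⟨J, rfl⟩
    refine ⟨LIdeal.inter I J, ?_⟩
    ext P
    constructor
    · rintro ⟨hI, hJ⟩ h
      exact (P.2.le_or_le h).elim hI hJ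
    · intro h
      exact ⟨fun hI => h fun x hx => hI hx.1, fun hJ => h fun x hx => hJ hx.2⟩
  isOpen_sUnion := by
    intro S hS
    refine ⟨LIdeal.span (⋃ I ∈ {I : LIdeal X | U I ∈ S}, (I : Set X)), ?_⟩
    ext P
    constructor
    · rintro ⟨V, hV, hPV⟩
      obtain ⟨I, rfl⟩ := hS V hV
      exact fun h => hPV fun x hx =>
        h (LIdeal.subset_span _ (Set.mem_biUnion (show I ∈ {I : LIdeal X | U I ∈ S} from hV) hx))
    · intro h
      by_contra hP
      refine h (LIdeal.span_le.2 (Set.iUnion₂_subset fun I hI => ?_))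
      by_contra hIP
      exact hP ⟨U I, hI, fun hle => hIP hle⟩

end Spectrum

end LAlgebra

/-!
The heart of the matter is that the lattice of ideals of an `L`-algebra is distributive
(`LIdeal.mem_span_inter_union_inter`). Every ideal `I` gives a congruence `I.Rel`, where `x` and
`y` are related if `x ⇝ y` and `y ⇝ x` lie in `I`. The class of `1` under any congruence is an
ideal, so an element `c` of `I ∨ J` is joined to `1` by a chain whose steps are related modulo `I`
or modulo `J`. If `c` also lies in an ideal `K`, the map `z ↦ (z ⇝ c) ⇝ c` sends the whole
chain into `K`, fixes `c` and `1`, and turns its steps into steps modulo `I ∩ K` or `J ∩ K`; hence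
`c ∈ (I ∩ K) ∨ (J ∩ K)`.

By distributivity, an ideal that is maximal among those avoiding a given element is prime, so every
ideal is an intersection of primes (`LIdeal.exists_isPrime`) and `I ↦ U I` is an order embedding of
the ideals into the open sets (`Spectrum.U_subset_U_iff`). Irreducible closed sets are then
complements of `U P` with `P` prime, which is the closure of `{P}`; and since a directed union of
ideals is an ideal, finitely generated ideals are exactly the compact elements of the lattice of
ideals, that is, they correspond to the quasi-compact open sets.
-/

namespace LAlgebra

namespace LIdeal

variable {X : Type*} [LAlgebra X]

theorem span_mono {s t : Set X} (h : s ⊆ t) : span s ≤ span t :=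
  span_le.2 (h.trans (subset_span t))

theorem span_singleton_le {x : X} {I : LIdeal X} : span {x} ≤ I ↔ x ∈ I :=
  span_le.trans Set.singleton_subset_iff

/-! ### Congruences and distributivity of the lattice of ideals -/

/-- The congruence modulo an ideal: `x` and `y` are related if both `x ⇝ y` and `y ⇝ x` lie in
the ideal. -/
def Rel (I : LIdeal X) (x y : X) : Prop := x ⇝ y ∈ I ∧ y ⇝ x ∈ I

namespace Rel

variable {I : LIdeal X} {x y z : X}

theorem of_mem (hx : x ∈ I) (hy : y ∈ I) : I.Rel x y :=
  ⟨I.op_mem' y x hy, I.op_mem' x y hx⟩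

theorem mono {J : LIdeal X} (h : I ≤ J) (hxy : I.Rel x y) : J.Rel x y :=
  ⟨h hxy.1, h hxy.2⟩

theorem symm (h : I.Rel x y) : I.Rel y x := ⟨h.2, h.1⟩

theorem trans (hxy : I.Rel x y) (hyz : I.Rel y z) : I.Rel x z := by
  have key : ∀ a b c : X, a ⇝ b ∈ I → b ⇝ c ∈ I → a ⇝ c ∈ I := fun a b c hab hbc =>
    I.mem_of_op_mem' _ _ hab (op_op_op a b c ▸ I.op_mem' _ (b ⇝ a) hbc)
  exact ⟨key x y z hxy.1 hyz.1, key z y x hyz.2 hxy.2⟩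

theorem op_left (h : I.Rel x y) (z : X) : I.Rel (z ⇝ x) (z ⇝ y) :=
  ⟨op_op_op x z y ▸ I.op_mem' _ (x ⇝ z) h.1, op_op_op y z x ▸ I.op_mem' _ (y ⇝ z) h.2⟩

/-- Modulo an ideal, the elements of the ideal act as the unit. -/
theorem op_of_mem (hx : x ∈ I) (y : X) : I.Rel (x ⇝ y) y :=
  ⟨I.op_op_mem' x y hx, I.op_op_mem_right' x y hx⟩

theorem op_right (h : I.Rel x y) (z : X) : I.Rel (x ⇝ z) (y ⇝ z) := by
  have h₁ := op_of_mem h.1 (x ⇝ z)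
  rw [op_op_op] at h₁
  exact h₁.symm.trans (op_of_mem h.2 (y ⇝ z))

end Rel

theorem rel_one_iff {I : LIdeal X} {x : X} : I.Rel x 1 ↔ x ∈ I :=
  ⟨fun h => by simpa only [one_op] using h.2, fun h => .of_mem h I.one_mem'⟩

/-- The class of `1` under a congruence, given as an equivalence relation compatible with the
operation on either side, is an ideal. The quotient need not be an `L`-algebra. -/
def ofCongruence (r : X → X → Prop) (hr : Equivalence r)
    (hl : ∀ x y z : X, r x y → r (z ⇝ x) (z ⇝ y))
    (hr' : ∀ x y z : X, r x y → r (x ⇝ z) (y ⇝ z)) : LIdeal X where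
  carrier := {x | r x 1}
  one_mem' := hr.refl 1
  mem_of_op_mem' x y hx hxy := by
    have h := hr' _ _ y hx
    rw [one_op] at h
    exact hr.trans (hr.symm h) hxy
  op_op_mem' x y hx := by
    have h := hr' _ _ y (hr' _ _ y hx)
    rwa [one_op, op_self] at h
  op_mem' x y hx := by
    have h := hl _ _ y hx
    rwa [op_one] at h
  op_op_mem_right' x y hx := by
    have h := hl _ _ y (hr' _ _ y hx)
    rwa [one_op, op_self] at h

theorem eqvGen_of_mem_span_union {I J : LIdeal X} {x : X}
    (hx : x ∈ span ((I : Set X) ∪ J)) :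
    Relation.EqvGen (fun a b => I.Rel a b ∨ J.Rel a b) x 1 := by
  refine hx (ofCongruence _ (Relation.EqvGen.is_equivalence _) ?_ ?_) ?_
  · intro a b z h
    induction h with
    | rel a b h => exact .rel _ _ (h.imp (·.op_left z) (·.op_left z))
    | refl a => exact .refl _
    | symm a b _ h => exact .symm _ _ h
    | trans a b c _ _ h₁ h₂ => exact .trans _ _ _ h₁ h₂
  · intro a b z h
    induction h with
    | rel a b h => exact .rel _ _ (h.imp (·.op_right z) (·.op_right z))
    | refl a => exact .refl _
    | symm a b _ h => exact .symm _ _ h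
    | trans a b c _ _ h₁ h₂ => exact .trans _ _ _ h₁ h₂
  · exact fun a ha => .rel _ _ (ha.imp rel_one_iff.2 rel_one_iff.2)

/-- Distributivity of the lattice of ideals: `(I ∨ J) ∩ K ≤ (I ∩ K) ∨ (J ∩ K)`. -/
theorem mem_span_inter_union_inter {I J K : LIdeal X} {c : X}
    (hc : c ∈ span ((I : Set X) ∪ J)) (hK : c ∈ K) :
    c ∈ span ((inter I K : Set X) ∪ inter J K) := by
  have hmem : ∀ a : X, (a ⇝ c) ⇝ c ∈ K := fun a => K.op_mem' _ _ hK
  have step : ∀ {M : LIdeal X} {a b : X}, M.Rel a b →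
      (inter M K).Rel ((a ⇝ c) ⇝ c) ((b ⇝ c) ⇝ c) := fun {M a b} h =>
    have h₁ := (h.op_right c).op_right c
    have h₂ := Rel.of_mem (hmem a) (hmem b)
    ⟨⟨h₁.1, h₂.1⟩, ⟨h₁.2, h₂.2⟩⟩
  have chain : ∀ a b : X, Relation.EqvGen (fun a b => I.Rel a b ∨ J.Rel a b) a b →
      (span ((inter I K : Set X) ∪ inter J K)).Rel ((a ⇝ c) ⇝ c) ((b ⇝ c) ⇝ c) := by
    intro a b h
    induction h with
    | rel a b h =>
      exact h.elim (fun h => (step h).mono fun _ hx => subset_span _ (.inl hx))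
        (fun h => (step h).mono fun _ hx => subset_span _ (.inr hx))
    | refl a => exact ⟨by rw [op_self]; exact one_mem' _, by rw [op_self]; exact one_mem' _⟩
    | symm a b _ h => exact h.symm
    | trans a b c _ _ h₁ h₂ => exact h₁.trans h₂
  have h := chain c 1 (eqvGen_of_mem_span_union hc)
  rw [one_op, op_self, one_op] at h
  exact rel_one_iff.1 h

/-! ### Directed unions and existence of prime ideals -/

/-- The union of a nonempty directed set of ideals. -/
def directedUnion (S : Set (LIdeal X)) (hne : S.Nonempty) (hS : DirectedOn (· ≤ ·) S) :
    LIdeal X where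
  carrier := {x | ∃ I ∈ S, x ∈ I}
  one_mem' := hne.imp fun I hI => ⟨hI, I.one_mem'⟩
  mem_of_op_mem' := by
    rintro x y ⟨I, hI, hx⟩ ⟨J, hJ, hxy⟩
    obtain ⟨K, hK, hIK, hJK⟩ := hS I hI J hJ
    exact ⟨K, hK, K.mem_of_op_mem' x y (hIK hx) (hJK hxy)⟩
  op_op_mem' := fun x y ⟨I, hI, hx⟩ => ⟨I, hI, I.op_op_mem' x y hx⟩
  op_mem' := fun x y ⟨I, hI, hx⟩ => ⟨I, hI, I.op_mem' x y hx⟩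
  op_op_mem_right' := fun x y ⟨I, hI, hx⟩ => ⟨I, hI, I.op_op_mem_right' x y hx⟩

theorem exists_finset_mem_span {ι : Type*} {J : ι → LIdeal X} {x : X}
    (hx : x ∈ span (⋃ i, (J i : Set X))) :
    ∃ t : Finset ι, x ∈ span (⋃ i ∈ t, (J i : Set X)) := by
  classical
  have hS : DirectedOn (· ≤ ·)
      (Set.range fun t : Finset ι => span (⋃ i ∈ t, (J i : Set X))) := by
    rintro _ ⟨t, rfl⟩ _ ⟨u, rfl⟩
    exact ⟨_, ⟨t ∪ u, rfl⟩,
      span_mono (Set.biUnion_subset_biUnion_left fun _ h => Finset.mem_union_left _ h),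
      span_mono (Set.biUnion_subset_biUnion_left fun _ h => Finset.mem_union_right _ h)⟩
  obtain ⟨_, ⟨t, rfl⟩, ht⟩ := hx (directedUnion _ (Set.range_nonempty _) hS) (by
    refine Set.iUnion_subset fun i y hy => ?_
    exact ⟨_, ⟨{i}, rfl⟩, subset_span _ (by simpa using hy)⟩)
  exact ⟨t, ht⟩

/-- Prime ideals are the meet-prime elements of the lattice of ideals; this is the converse of
`IsPrime.le_or_le`. -/
theorem isPrime_of_le_or_le {P : LIdeal X} (hne : (P : Set X) ≠ Set.univ)
    (h : ∀ I J : LIdeal X, inter I J ≤ P → I ≤ P ∨ J ≤ P) : P.IsPrime := by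
  refine ⟨hne, fun I => or_iff_not_imp_left.2 fun hI x hx => ?_⟩
  exact span_singleton_le.1 ((h (span {x}) I hx).resolve_right hI)

/-- Every ideal is the intersection of the prime ideals containing it. -/
theorem exists_isPrime {I : LIdeal X} {x : X} (hx : x ∉ I) :
    ∃ P : LIdeal X, P.IsPrime ∧ I ≤ P ∧ x ∉ P := by
  obtain ⟨P, hIP, hP⟩ := zorn_le_nonempty₀ {J : LIdeal X | x ∉ J} (by
    intro S hS hchain J hJ
    refine ⟨directedUnion S ⟨J, hJ⟩ hchain.directedOn, ?_, fun K hK y hy => ⟨K, hK, hy⟩⟩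
    rintro ⟨K, hK, hxK⟩
    exact hS hK hxK) I hx
  have hxP : x ∉ P := hP.prop
  have hsup : ∀ J : LIdeal X, ¬ J ≤ P → x ∈ span ((P : Set X) ∪ J) := by
    intro J hJ
    by_contra hxJ
    exact hJ fun y hy => hP.le_of_ge hxJ (fun z hz => subset_span _ (.inl hz))
      (subset_span _ (.inr hy))
  refine ⟨P, isPrime_of_le_or_le (fun h => hxP (h ▸ Set.mem_univ x : x ∈ (P : Set X))) ?_,
    hIP, hxP⟩
  intro J K hJK
  by_contra! hnot
  -- Distributivity is used twice, to get `(P ∨ J) ∩ (P ∨ K) ≤ P ∨ (J ∩ K) = P`.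
  refine hxP ((span_le.2 (Set.union_subset (fun y hy => hy.1) ?_) : span _ ≤ P)
    (mem_span_inter_union_inter (hsup J hnot.1) (hsup K hnot.2)))
  rintro y ⟨hyJ, hyPK⟩
  refine (span_le.2 (Set.union_subset (fun z hz => hz.1) ?_) : span _ ≤ P)
    (mem_span_inter_union_inter hyPK hyJ)
  exact fun z hz => hJK ⟨hz.2, hz.1⟩

end LIdeal

namespace Spectrum

open LIdeal

variable {X : Type*} [LAlgebra X]

/-! ### The topology of the spectrum -/

theorem isOpen_U (I : LIdeal X) : IsOpen (U I) := ⟨I, rfl⟩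

theorem U_subset_U_iff {I J : LIdeal X} : U I ⊆ U J ↔ I ≤ J := by
  refine ⟨fun h x hx => ?_, fun h P hI hJ => hI fun x hx => hJ (h hx)⟩
  by_contra hxJ
  obtain ⟨P, hP, hJP, hxP⟩ := exists_isPrime hxJ
  exact h (show (⟨P, hP⟩ : Spectrum X) ∈ U I from fun hI => hxP (hI hx)) hJP

theorem U_injective : Function.Injective (U (X := X)) := fun _ _ h =>
  le_antisymm (U_subset_U_iff.1 h.le) (U_subset_U_iff.1 h.ge)

theorem U_span_iUnion {ι : Sort*} (J : ι → LIdeal X) :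
    U (span (⋃ i, (J i : Set X))) = ⋃ i, U (J i) := by
  ext P
  simp only [U, Set.mem_ofPred_eq, Set.mem_iUnion, span_le, Set.iUnion_subset_iff, not_forall]
  rfl

theorem closure_singleton (P : Spectrum X) : closure {P} = (U P.1)ᶜ := by
  refine subset_antisymm (closure_minimal ?_ (isOpen_U P.1).isClosed_compl) ?_
  · rintro _ rfl h
    exact h le_rfl
  · intro Q hQ
    refine mem_closure_iff.2 ?_
    rintro _ ⟨I, rfl⟩ hQI
    exact ⟨P, fun hIP => hQI fun x hx => not_not.1 hQ (hIP hx), rfl⟩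

theorem eq_of_closure_singleton_eq {P Q : Spectrum X} (h : closure {P} = closure {Q}) :
    P = Q := by
  rw [closure_singleton, closure_singleton, compl_inj_iff] at h
  exact Subtype.ext (U_injective h)

instance : T0Space (Spectrum X) :=
  ⟨fun _ _ h => eq_of_closure_singleton_eq (inseparable_iff_closure_eq.1 h)⟩

theorem existsUnique_closure_singleton_eq {A : Set (Spectrum X)} (hc : IsClosed A)
    (hA : IsIrreducible A) : ∃! P : Spectrum X, closure {P} = A := by
  obtain ⟨I, hI⟩ := hc.isOpen_compl
  have hdisj : ∀ {J : LIdeal X}, ¬ J ≤ I → (A ∩ U J).Nonempty := by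
    intro J hJ
    rw [← U_subset_U_iff, Set.not_subset, ← hI] at hJ
    obtain ⟨P, hPJ, hPA⟩ := hJ
    exact ⟨P, not_not.1 hPA, hPJ⟩
  have hprime : I.IsPrime := by
    refine isPrime_of_le_or_le ?_ ?_
    · intro h
      obtain ⟨P, hP⟩ := hA.1
      have hPI : P ∉ U I := hI ▸ not_not.2 hP
      refine P.2.1 (Set.eq_univ_of_forall fun x => not_not.1 hPI ?_)
      exact (h ▸ Set.mem_univ x : x ∈ (I : Set X))
    · intro J K hJK
      by_contra! hnot
      obtain ⟨P, hPA, hPJ, hPK⟩ := hA.2 _ _ (isOpen_U J) (isOpen_U K) (hdisj hnot.1)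
        (hdisj hnot.2)
      have hPI : I ≤ P.1 := not_not.1 (show P ∉ U I from hI ▸ not_not.2 hPA)
      exact (P.2.le_or_le fun x hx => hPI (hJK hx)).elim hPJ hPK
  obtain ⟨P, rfl⟩ : ∃ P : Spectrum X, P.1 = I := ⟨⟨I, hprime⟩, rfl⟩
  have hcl : closure {P} = A := by
    rw [closure_singleton, ← hI, compl_compl]
  exact ⟨P, hcl, fun Q hQ => eq_of_closure_singleton_eq (hQ.trans hcl.symm)⟩

theorem isCompact_U_span_singleton (x : X) : IsCompact (U (span {x})) := by
  refine isCompact_of_finite_subcover fun {ι} V hV hcover => ?_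
  choose J hJ using hV
  obtain rfl : V = fun i => U (J i) := funext hJ
  rw [← U_span_iUnion, U_subset_U_iff, span_singleton_le] at hcover
  obtain ⟨t, ht⟩ := exists_finset_mem_span hcover
  refine ⟨t, ?_⟩
  intro P hP
  by_contra hPt
  simp only [Set.mem_iUnion, not_exists] at hPt
  refine hP (span_singleton_le.2 (span_le.2 (Set.iUnion₂_subset fun i hi => ?_) ht))
  exact not_not.1 (hPt i hi)

theorem U_span (s : Set X) : U (span s) = ⋃ x ∈ s, U (span {x}) := by
  ext P
  simp only [U, Set.mem_ofPred_eq, Set.mem_iUnion, span_singleton_le]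
  rw [span_le, Set.not_subset]
  simp only [exists_prop]
  rfl

theorem isCompact_U_iff {I : LIdeal X} : IsCompact (U I) ↔ I.FG := by
  constructor
  · intro h
    have hcover : U I ⊆ ⋃ x ∈ (I : Set X), U (span {x}) := by
      rw [← U_span, U_subset_U_iff]
      exact subset_span _
    obtain ⟨s, hsI, hs, hIs⟩ := h.elim_finite_subcover_image (fun x _ => isOpen_U _) hcover
    rw [← U_span, U_subset_U_iff] at hIs
    exact ⟨s, hs, le_antisymm hIs (span_le.2 hsI)⟩
  · rintro ⟨s, hs, rfl⟩
    rw [U_span]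
    exact hs.isCompact_biUnion fun x _ => isCompact_U_span_singleton x

theorem isTopologicalBasis_isOpen_isCompact :
    TopologicalSpace.IsTopologicalBasis {V : Set (Spectrum X) | IsOpen V ∧ IsCompact V} := by
  refine TopologicalSpace.isTopologicalBasis_of_isOpen_of_nhds (fun V hV => hV.1) ?_
  rintro P _ hP ⟨I, rfl⟩
  obtain ⟨x, hxI, hxP⟩ := Set.not_subset.1 hP
  exact ⟨U (span {x}), ⟨isOpen_U _, isCompact_U_span_singleton x⟩,
    fun h => hxP (span_singleton_le.1 h), U_subset_U_iff.2 (span_singleton_le.2 hxI)⟩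

end Spectrum

end LAlgebra

theorem proposition3 (X : Type*) [LAlgebra X] :
    T0Space (LAlgebra.Spectrum X) ∧
    (∀ A : Set (LAlgebra.Spectrum X), A.Nonempty → IsClosed A → IsIrreducible A →
      ∃! P : LAlgebra.Spectrum X, closure {P} = A) ∧
    TopologicalSpace.IsTopologicalBasis
      {V : Set (LAlgebra.Spectrum X) | IsOpen V ∧ IsCompact V} ∧
    (∀ I : LAlgebra.LIdeal X, IsCompact (LAlgebra.Spectrum.U I) ↔ I.FG) ∧
    Set.BijOn (LAlgebra.Spectrum.U (X := X)) {I : LAlgebra.LIdeal X | I.FG}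
      {V : Set (LAlgebra.Spectrum X) | IsOpen V ∧ IsCompact V} := by
  refine ⟨inferInstance,
    fun A _ hc hA => LAlgebra.Spectrum.existsUnique_closure_singleton_eq hc hA,
    LAlgebra.Spectrum.isTopologicalBasis_isOpen_isCompact,
    fun I => LAlgebra.Spectrum.isCompact_U_iff,
    fun I hI => ⟨LAlgebra.Spectrum.isOpen_U I, LAlgebra.Spectrum.isCompact_U_iff.2 hI⟩,
    LAlgebra.Spectrum.U_injective.injOn, ?_⟩
  rintro _ ⟨⟨I, rfl⟩, hI⟩
  exact ⟨I, LAlgebra.Spectrum.isCompact_U_iff.1 hI, rfl⟩
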